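/- **Setting.** For $\alpha\in(0,2]$, $\beta\in[-1,1]$, $\gamma>0$, $\delta\in\mathbb R$, let $\mathbf S(\alpha,\beta,\gamma,\delta)$ be the stable distribution, i.e. the probability law on $\mathbb R$ with characteristic function $$u\mapsto\begin{cases}\exp\!\big(-\gamma^\alpha|u|^\alpha[1-i\beta\tan(\tfrac{\pi\alpha}{2})\operatorname{sign}(u)]+i\delta u\big),&\alpha\ne1,\\ \exp\!\big(-\gamma|u|[1+i\beta\tfrac2\pi\operatorname{sign}(u)\log|u|]+i\delta u\big),&\alpha=1.\end{cases}$$ A *subtest* $\mathcal H$ consists of a null and an alternative hypothesis (sets $\mathcal P_0,\mathcal P_1$ of laws of a data set) and a measurable p-value $p\in[0,1]$ computed from the data set. Its p-value is assumed *well defined*: it is uniform on $[0,1]$ under every $P\in\mathcal P_0$. Let $K\ge1$ and let $p_1,\dots,p_K$ be the p-values of $\mathcal H$ on $K$ independent data sets with the same law $P$. The *ensemble test* $\mathcal H_e$ has statistic and p-value $$T_e=\frac1K\sum_{k=1}^K F_S^{-1}(p_k),\qquad p_e=F_{S'}(T_e),$$ where $F_S$ is the CDF of $\mathbf S(\alpha,\beta,\gamma,\delta)$,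 $F_S^{-1}(p)=\inf\{x\in[-\infty,\infty]:F_S(x)\ge p\}$, and $F_{S'}$ is the CDF of $\mathbf S(\alpha,\beta,\gamma',\delta)$ with $\gamma'=K^{1/\alpha-1}\gamma$ (CDFs are extended by $F(-\infty)=0$, $F(+\infty)=1$, and $-\infty+\infty=-\infty$ in $T_e$). At level $a$ it rejects iff $p_e\le a$. **Theorem.** 1. (*Validity.*) Suppose that $\alpha\neq1$ or $\beta=0$ or $K=1$. Under every law in the null hypothesis, $p_e$ is uniformly distributed on $[0,1]$; in particular its Type I error at each level $a\in[0,1]$ is exactly $a$. 2. (*Admissibility.*) Suppose that the null hypothesis is non-empty and that the alternative is nonparametric: under each $P\in\mathcal P_1$ the subtest p-value has a density, and every nonincreasing probability density on $[0,1]$ other than the uniform one is the density of the p-value under some $P\in\mathcal P_1$. Then, for every level $a\in(0,1)$, the ensemble test of level $a$ is admissible among all (possibly randomized) tests based on $(p_1,\dots,p_K)$: there is no such test whose rejection probability is at most that of the ensemble test under every null law and at least that of the ensemble test under every alternative law, with strict inequality for at least one null or alternative law. 3. (*Unbiasedness.*) Suppose that $\alpha\neq1$ or $\beta=0$ or $K=1$.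 If the subtest is unbiased, i.e. $P(p\le a)\ge a$ for all $a\in(0,1)$ and all $P\in\mathcal P_1$, then so is the ensemble test: when the $K$ data sets are independent with common law $P$, $\Pr(p_e\le a)\ge a$ for all $a\in(0,1)$ and all $P\in\mathcal P_1$. -/

import Mathlib

open MeasureTheory ProbabilityTheory Set
open scoped ENNReal

noncomputable section

namespace ECIT

/-! ### Stable distributions -/

/-- The characteristic function of the stable distribution `S(α, β, γ, δ)`. -/
def stableCharFun (α β γ δ u : ℝ) : ℂ :=
  if α = 1 then
    Complex.exp (-((γ * |u| : ℝ) : ℂ) *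
        (1 + Complex.I * ((β * (2 / Real.pi) * Real.sign u * Real.log |u| : ℝ) : ℂ))
      + Complex.I * ((δ * u : ℝ) : ℂ))
  else
    Complex.exp (-((γ ^ α * |u| ^ α : ℝ) : ℂ) *
        (1 - Complex.I * ((β * Real.tan (Real.pi * α / 2) * Real.sign u : ℝ) : ℂ))
      + Complex.I * ((δ * u : ℝ) : ℂ))

/-- `μ` is the stable distribution `S(α, β, γ, δ)`: a probability measure on the line with
admissible parameters and the prescribed characteristic function (which determines it). -/
structure IsStable (μ : Measure ℝ) (α β γ δ : ℝ) : Prop where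
  isProb : IsProbabilityMeasure μ
  alpha_pos : 0 < α
  alpha_le : α ≤ 2
  beta_mem : β ∈ Icc (-1 : ℝ) 1
  gamma_pos : 0 < γ
  charFun_eq : ∀ u : ℝ, charFun μ u = stableCharFun α β γ δ u

/-! ### Distribution function and quantile function on the extended line -/

/-- The CDF of `μ`, on the extended real line: `F(x) = μ(-∞, x]`, `F(-∞) = 0`, and
`F(+∞)` is the total mass. -/
def ecdf (μ : Measure ℝ) (x : EReal) : ℝ :=
  μ.real {y : ℝ | (y : EReal) ≤ x}

/-- The inverse CDF of `μ`, `F⁻¹(p) = inf {x : p ≤ F(x)}`, with values in the extended real line.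
It is finite for `0 < p < 1`, and `F⁻¹(0) = -∞`. -/
def quantile (μ : Measure ℝ) (p : ℝ) : EReal :=
  sInf {x : EReal | p ≤ ecdf μ x}

/-- On real arguments `ecdf` is the usual distribution function. -/
theorem ecdf_coe (μ : Measure ℝ) [IsProbabilityMeasure μ] (x : ℝ) :
    ecdf μ (x : EReal) = cdf μ x := by
  rw [cdf_eq_real, ecdf]
  congr 1
  ext y
  simp

/-! ### Subtests -/

/-- The uniform distribution on `[0, 1]`. -/
def uniform01 : Measure ℝ := volume.restrict (Icc 0 1)

/-- A hypothesis test reported through its p-value: a null and an alternative hypothesis (sets of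
possible laws of the data set `x : X`), and a p-value computed from the data. -/
structure Subtest (X : Type*) [MeasurableSpace X] where
  null : Set (ProbabilityMeasure X)
  alt : Set (ProbabilityMeasure X)
  pval : X → ℝ
  measurable_pval : Measurable pval
  pval_mem : ∀ x, pval x ∈ Icc (0 : ℝ) 1

variable {X : Type*} [MeasurableSpace X]

/-- The law of the subtest's p-value when the data have law `P`. -/
def Subtest.pvalLaw (H : Subtest X) (P : ProbabilityMeasure X) : Measure ℝ :=
  (P : Measure X).map H.pval

/-- The p-value of the subtest is well defined: it is uniform on `[0, 1]` under the null. -/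
def Subtest.IsExact (H : Subtest X) : Prop :=
  ∀ P ∈ H.null, H.pvalLaw P = uniform01

/-- The subtest is unbiased: at every level, its rejection probability under each alternative is
at least the level. -/
def Subtest.IsUnbiased (H : Subtest X) : Prop :=
  ∀ a ∈ Ioo (0 : ℝ) 1, ∀ P ∈ H.alt, a ≤ (P : Measure X).real {x | H.pval x ≤ a}

/-- `Q` is a probability law on `[0, 1]` with a nonincreasing density. -/
def HasNonincreasingDensity (Q : Measure ℝ) : Prop :=
  IsProbabilityMeasure Q ∧
    ∃ f : ℝ → ℝ≥0∞, AntitoneOn f (Icc 0 1) ∧ Q = uniform01.withDensity f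

/-- The alternative is nonparametric: p-values have a density under every alternative, and every
nonuniform nonincreasing density on `[0, 1]` is the density of the p-value under some
alternative. -/
def Subtest.IsNonparametric (H : Subtest X) : Prop :=
  (∀ P ∈ H.alt, H.pvalLaw P ≪ volume) ∧
    ∀ Q : Measure ℝ, HasNonincreasingDensity Q → Q ≠ uniform01 → ∃ P ∈ H.alt, H.pvalLaw P = Q

/-! ### The ensemble test -/

/-- The law of `K` independent data sets with common law `P`. -/
def dataLaw (K : ℕ) (P : ProbabilityMeasure X) : Measure (Fin K → X) :=
  Measure.pi fun _ => (P : Measure X)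

/-- The ensemble statistic `T_e = K⁻¹ ∑ₖ F_S⁻¹(pₖ)`. -/
def ensembleStat (S : Measure ℝ) {K : ℕ} (p : Fin K → ℝ) : EReal :=
  (((K : ℝ)⁻¹ : ℝ) : EReal) * ∑ k, quantile S (p k)

/-- The ensemble p-value `p_e = F_{S'}(T_e)`. -/
def ensemblePval (S S' : Measure ℝ) {K : ℕ} (p : Fin K → ℝ) : ℝ :=
  ecdf S' (ensembleStat S p)

/-- The p-values of the `K` subtests. -/
def Subtest.pvals (H : Subtest X) {K : ℕ} (x : Fin K → X) : Fin K → ℝ :=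
  fun k => H.pval (x k)

/-- The critical function of the ensemble test of level `a`: reject iff `p_e ≤ a`. -/
def ensembleTest (S S' : Measure ℝ) (K : ℕ) (a : ℝ) : (Fin K → ℝ) → ℝ :=
  {p | ensemblePval S S' p ≤ a}.indicator fun _ => 1

/-! ### Admissibility of a combination of p-values -/

/-- A (possibly randomized) test based on `K` p-values, given by its critical function: `φ p` is
the probability of rejecting the null when the p-values are `p`. -/
def IsTest {K : ℕ} (φ : (Fin K → ℝ) → ℝ) : Prop :=
  Measurable φ ∧ ∀ p, φ p ∈ Icc (0 : ℝ) 1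

/-- The rejection probability of the test `φ` applied to the p-values of `K` independent subtests
whose data have law `P`. -/
def Subtest.rejProb (H : Subtest X) {K : ℕ} (φ : (Fin K → ℝ) → ℝ) (P : ProbabilityMeasure X) : ℝ :=
  ∫ x, φ (H.pvals x) ∂(dataLaw K P)

/-- `φ` uniformly outperforms `ψ`: its error probabilities (of both types) are nowhere larger than
those of `ψ`, and somewhere strictly smaller. -/
def Subtest.Dominates (H : Subtest X) {K : ℕ} (φ ψ : (Fin K → ℝ) → ℝ) : Prop :=
  (∀ P ∈ H.null, H.rejProb φ P ≤ H.rejProb ψ P) ∧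
    (∀ P ∈ H.alt, H.rejProb ψ P ≤ H.rejProb φ P) ∧
      ((∃ P ∈ H.null, H.rejProb φ P < H.rejProb ψ P) ∨
        ∃ P ∈ H.alt, H.rejProb ψ P < H.rejProb φ P)

/-- `ψ` is admissible among all tests based on the `K` p-values. -/
def Subtest.IsAdmissible (H : Subtest X) {K : ℕ} (ψ : (Fin K → ℝ) → ℝ) : Prop :=
  IsTest ψ ∧ ∀ φ : (Fin K → ℝ) → ℝ, IsTest φ → ¬ H.Dominates φ ψ

end ECIT

end

/-!
The mean of `K` independent copies of `S(α, β, γ, δ)` is `S(α, β, K^{1/α - 1} γ, δ)` when `α ≠ 1`,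
`β = 0` or `K = 1` (`IsStable.map_mean`, by characteristic functions). Since `F_S⁻¹(U)` has law `S`
for `U` uniform (`map_realQuantile`), the statistic `T_e` has law `S'` under the null. A stable law
has no atoms because its characteristic function vanishes at infinity
(`nullSingletonClass_of_tendsto_charFun`), so the probability integral transform `map_cdf` makes
`p_e` uniform. This is validity.

Unbiasedness follows by coupling. An unbiased subtest has p-values stochastically smaller than
uniform, so the quantile function of their law sends a uniform `u` to a point at most `u`; as `p_e`
is monotone in each p-value, its law is stochastically smaller than uniform as well
(`pi_real_ensemblePval_le_of_le`).

For admissibility, note that the test rejects iff `∑ₖ F_S⁻¹(pₖ) ≤ t` for some real `t`. This is the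
Neyman–Pearson test of the uniform law against the "density" `exp (-F_S⁻¹(p))`, nonincreasing in
`p`, except that this function need not be integrable near `0`. The truncated functions
`exp (-max (F_S⁻¹(p)) (-n))` are bounded and do give alternatives after normalization. If `φ`
dominates the ensemble test `ψ`, then `φ - ψ` has nonnegative integral against each of the
corresponding product densities, and its integral under the uniform law is zero: at most zero by
comparison under the null, at least zero because the uniform law is a limit of alternatives.
Truncating from below only ever increases the statistic, so it affects the Neyman–Pearson
inequality only on the rejection region, where the error is bounded, and Fatou's lemma gives
`φ = ψ` almost everywhere (`ae_eq_of_integral_mul_exp_nonneg`, `ae_eq_of_power_le`). All laws in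
question have densities, so no strict improvement is possible. No relation between the scales of
`S` and `S'` is used here.
-/

namespace ECIT

open Filter Topology

/-! ### Laws with vanishing characteristic function at infinity -/

/-- Averaging `charFun μ (n z)` over a standard Gaussian `z` gives a quantity that tends to `0` by
assumption, and to the mass of `μ` at `0` by exchanging the two integrals. -/
theorem measureReal_singleton_zero_of_tendsto_charFun {μ : Measure ℝ} [IsProbabilityMeasure μ]
    (h : Tendsto (fun u => ‖charFun μ u‖) (cocompact ℝ) (𝓝 0)) : μ.real {0} = 0 := by
  set ν : Measure ℝ := gaussianReal 0 1
  have hνa : NullSingletonClass ν := nullSingletonClass_gaussianReal one_ne_zero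
  -- Fubini; both sides are the double integral of `exp (i n z x)`
  have swap : ∀ n : ℕ, ∫ z, charFun μ (n * z) ∂ν = ∫ x, charFun ν (n * x) ∂μ := by
    intro n
    simp_rw [charFun_apply_real]
    rw [integral_integral_swap]
    · refine integral_congr_ae (.of_forall fun x => integral_congr_ae (.of_forall fun z => ?_))
      dsimp only
      congr 1
      push_cast
      ring
    · refine Integrable.of_bound (C := 1) ?_ (.of_forall fun p => ?_)
      · exact Measurable.aestronglyMeasurable (by unfold Function.uncurry; fun_prop)
      · have : (((n * p.1 : ℝ) : ℂ) * (p.2 : ℂ) * Complex.I)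
            = ((n * p.1 * p.2 : ℝ) : ℂ) * Complex.I := by push_cast; ring
        simp only [Function.uncurry]
        rw [this, Complex.norm_exp_ofReal_mul_I]
  have h1 : Tendsto (fun n : ℕ => ∫ z, charFun μ (n * z) ∂ν) atTop (𝓝 (∫ _, (0 : ℂ) ∂ν)) := by
    refine tendsto_integral_of_dominated_convergence (fun _ => 1) (fun n => ?_)
      (integrable_const _) (fun n => .of_forall fun z => norm_charFun_le_one _) ?_
    · exact (measurable_charFun.comp (measurable_const.mul measurable_id)).aestronglyMeasurable
    · have : ∀ᵐ z ∂ν, z ≠ 0 := by simp [ae_iff]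
      filter_upwards [this] with z hz
      rw [tendsto_zero_iff_norm_tendsto_zero]
      refine h.comp ?_
      rw [← Metric.cobounded_eq_cocompact, ← comap_norm_atTop (E := ℝ), tendsto_comap_iff]
      have : (norm ∘ fun n : ℕ => (n : ℝ) * z) = fun n : ℕ => (n : ℝ) * ‖z‖ := by
        ext n; simp
      rw [this]
      exact tendsto_natCast_atTop_atTop.atTop_mul_const (norm_pos_iff.2 hz)
  have h2 : Tendsto (fun n : ℕ => ∫ x, charFun ν (n * x) ∂μ) atTop
      (𝓝 (∫ x, ({0} : Set ℝ).indicator (fun _ => (1 : ℂ)) x ∂μ)) := by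
    refine tendsto_integral_of_dominated_convergence (fun _ => 1) (fun n => ?_)
      (integrable_const _) (fun n => .of_forall fun z => norm_charFun_le_one _)
      (.of_forall fun x => ?_)
    · exact (measurable_charFun.comp (measurable_const.mul measurable_id)).aestronglyMeasurable
    · by_cases hx : x = 0
      · subst hx; simp
      · rw [indicator_of_notMem (by simpa using hx), tendsto_zero_iff_norm_tendsto_zero]
        have : ∀ n : ℕ, ‖charFun ν (n * x)‖ = Real.exp (-(x ^ 2 / 2 * (n : ℝ) ^ 2)) := by
          intro n
          rw [charFun_gaussianReal]
          have : ((n * x : ℝ) : ℂ) * ((0 : ℝ) : ℂ) * Complex.I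
              - (((1 : NNReal) : ℝ) : ℂ) * ((n * x : ℝ) : ℂ) ^ 2 / 2
              = ((-(x ^ 2 / 2 * (n : ℝ) ^ 2) : ℝ) : ℂ) := by push_cast; ring
          rw [this, Complex.norm_exp_ofReal]
        simp_rw [this]
        refine Real.tendsto_exp_neg_atTop_nhds_zero.comp ?_
        refine Tendsto.const_mul_atTop (by positivity) ?_
        exact (tendsto_pow_atTop two_ne_zero).comp tendsto_natCast_atTop_atTop
  have h3 := tendsto_nhds_unique (h1.congr swap) h2
  rw [integral_zero, integral_indicator_const _ (measurableSet_singleton 0)] at h3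
  simpa using h3.symm

theorem nullSingletonClass_of_tendsto_charFun {μ : Measure ℝ} [IsProbabilityMeasure μ]
    (h : Tendsto (fun u => ‖charFun μ u‖) (cocompact ℝ) (𝓝 0)) : NullSingletonClass μ := by
  refine ⟨fun x => ?_⟩
  have hm : Measurable fun y : ℝ => y + (-x) := measurable_id.add_const _
  have : IsProbabilityMeasure (μ.map fun y => y + (-x)) :=
    Measure.isProbabilityMeasure_map hm.aemeasurable
  have := measureReal_singleton_zero_of_tendsto_charFun (μ := μ.map fun y => y + (-x)) (by
    refine h.congr fun u => ?_
    rw [charFun_map_add_const, norm_mul, Complex.norm_exp_ofReal_mul_I, mul_one])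
  rw [map_measureReal_apply hm (measurableSet_singleton 0)] at this
  have e : (fun y : ℝ => y + (-x)) ⁻¹' {0} = {x} := by
    ext y
    simp [← sub_eq_add_neg, sub_eq_zero]
  rw [e, measureReal_eq_zero_iff] at this
  exact this

/-! ### Stable laws -/

theorem norm_stableCharFun {α β γ δ : ℝ} (u : ℝ) :
    ‖stableCharFun α β γ δ u‖ = Real.exp (-(γ ^ α * |u| ^ α)) := by
  unfold stableCharFun
  split_ifs with h
  · subst h
    rw [Complex.norm_exp]
    simp
  · rw [Complex.norm_exp]
    simp only [← Complex.ofReal_neg, Complex.add_re, Complex.re_ofReal_mul, Complex.sub_re,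
      Complex.one_re, Complex.I_mul_re, Complex.ofReal_im, neg_zero, sub_zero, mul_one, add_zero]

theorem IsStable.nullSingletonClass {S : Measure ℝ} {α β γ δ : ℝ} (h : IsStable S α β γ δ) :
    NullSingletonClass S := by
  have := h.isProb
  refine nullSingletonClass_of_tendsto_charFun ?_
  simp_rw [h.charFun_eq, norm_stableCharFun]
  refine Real.tendsto_exp_neg_atTop_nhds_zero.comp ?_
  refine Tendsto.const_mul_atTop (Real.rpow_pos_of_pos h.gamma_pos _) ?_
  have := tendsto_norm_cocompact_atTop (E := ℝ)
  exact (tendsto_rpow_atTop h.alpha_pos).comp this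

/-- The scaling relation behind the ensemble test: the `K`-th power of the characteristic function
of `S(α, β, γ, δ)` at `u / K` is that of `S(α, β, K^{1/α - 1} γ, δ)` at `u`. For `α = 1` and
`K ≠ 1` the logarithmic term breaks it unless `β = 0`. -/
theorem stableCharFun_pow {α β γ δ : ℝ} {K : ℕ} (hK : 1 ≤ K) (hα : 0 < α) (hγ : 0 < γ)
    (h : α ≠ 1 ∨ β = 0 ∨ K = 1) (u : ℝ) :
    stableCharFun α β γ δ ((K : ℝ)⁻¹ * u) ^ K
      = stableCharFun α β ((K : ℝ) ^ (1 / α - 1) * γ) δ u := by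
  have hK0 : (0 : ℝ) < K := by exact_mod_cast hK
  have hKC : (K : ℂ) ≠ 0 := by exact_mod_cast hK0.ne'
  by_cases hK1 : K = 1
  · subst hK1; simp
  unfold stableCharFun
  split_ifs with h1
  · have hβ : β = 0 := by tauto
    subst hβ h1
    rw [← Complex.exp_nat_mul, abs_mul, abs_of_pos (inv_pos.2 hK0)]
    congr 1
    simp only [zero_mul, Complex.ofReal_zero, mul_zero, add_zero, mul_one, div_one, sub_self,
      Real.rpow_zero, one_mul]
    push_cast
    field_simp
  · have hs : Real.sign ((K : ℝ)⁻¹ * u) = Real.sign u := by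
      rcases lt_trichotomy u 0 with hu | hu | hu
      · rw [Real.sign_of_neg hu, Real.sign_of_neg (mul_neg_of_pos_of_neg (inv_pos.2 hK0) hu)]
      · simp [hu]
      · rw [Real.sign_of_pos hu, Real.sign_of_pos (mul_pos (inv_pos.2 hK0) hu)]
    have hp : (K : ℝ) * (γ ^ α * |(K : ℝ)⁻¹ * u| ^ α)
        = ((K : ℝ) ^ (1 / α - 1) * γ) ^ α * |u| ^ α := by
      rw [abs_mul, abs_of_pos (inv_pos.2 hK0), Real.mul_rpow (inv_pos.2 hK0).le (abs_nonneg _),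
        Real.mul_rpow (Real.rpow_nonneg hK0.le _) hγ.le, ← Real.rpow_mul hK0.le,
        Real.inv_rpow hK0.le, ← Real.rpow_neg hK0.le]
      have : (1 / α - 1) * α = 1 + -α := by field_simp; ring
      rw [this, Real.rpow_add hK0, Real.rpow_one]
      ring
    rw [← Complex.exp_nat_mul, hs, ← hp]
    congr 1
    push_cast
    field_simp

/-- The mean of `K` independent `S(α, β, γ, δ)` variables has law
`S(α, β, K^{1/α - 1} γ, δ)`. -/
theorem IsStable.map_mean {α β γ δ : ℝ} {S S' : Measure ℝ} {K : ℕ} (hK : 1 ≤ K)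
    (hS : IsStable S α β γ δ) (hS' : IsStable S' α β ((K : ℝ) ^ (1 / α - 1) * γ) δ)
    (h : α ≠ 1 ∨ β = 0 ∨ K = 1) :
    (Measure.pi fun _ : Fin K => S).map (fun x => (K : ℝ)⁻¹ * ∑ k, x k) = S' := by
  have := hS.isProb
  have := hS'.isProb
  have hm : Measurable fun x : Fin K → ℝ => ∑ k, x k := by fun_prop
  have e : (Measure.pi fun _ : Fin K => S).map (fun x => (K : ℝ)⁻¹ * ∑ k, x k)
      = ((Measure.pi fun _ : Fin K => S).map fun x => ∑ k, x k).map fun y => (K : ℝ)⁻¹ * y := by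
    rw [Measure.map_map (by fun_prop) hm]; rfl
  rw [e]
  refine Measure.ext_of_charFun ?_
  ext u
  rw [charFun_map_mul, charFun_map_sum_pi_eq_prod, Finset.prod_const, Finset.card_fin,
    Pi.pow_apply, hS.charFun_eq, hS'.charFun_eq,
    stableCharFun_pow hK hS.alpha_pos hS.gamma_pos h]

/-! ### The quantile function -/

instance : IsProbabilityMeasure uniform01 := ⟨by simp [uniform01]⟩

theorem monotone_ecdf (μ : Measure ℝ) [IsFiniteMeasure μ] : Monotone (ecdf μ) := fun _ _ h =>
  measureReal_mono fun _ hz => le_trans hz h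

theorem monotone_quantile (μ : Measure ℝ) : Monotone (quantile μ) := fun _ _ h =>
  sInf_le_sInf fun _ hx => h.trans hx

/-- The Galois connection between the quantile function and the distribution function. -/
theorem quantile_le_coe_iff (μ : Measure ℝ) [IsProbabilityMeasure μ] {p y : ℝ} :
    quantile μ p ≤ (y : EReal) ↔ p ≤ cdf μ y := by
  refine ⟨fun h => ?_, fun h => sInf_le (by simpa [ecdf_coe] using h)⟩
  have hr : Tendsto (cdf μ) (𝓝[>] y) (𝓝 (cdf μ y)) :=
    ((cdf μ).right_continuous y).mono_left (nhdsWithin_mono _ Ioi_subset_Ici_self)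
  refine ge_of_tendsto hr ?_
  filter_upwards [self_mem_nhdsWithin] with z hz
  have hz' : quantile μ p < (z : EReal) := h.trans_lt (EReal.coe_lt_coe_iff.2 hz)
  obtain ⟨x, hx, hxz⟩ := sInf_lt_iff.1 hz'
  rw [← ecdf_coe]
  exact le_trans hx (monotone_ecdf μ hxz.le)

/-- The quantile function with values in `ℝ`; outside the open interval `(0, 1)` infinite
quantiles are replaced by `0`. -/
noncomputable def realQuantile (μ : Measure ℝ) (p : ℝ) : ℝ := (quantile μ p).toReal

theorem coe_realQuantile (μ : Measure ℝ) [IsProbabilityMeasure μ] {p : ℝ} (hp : p ∈ Ioo (0 : ℝ) 1) :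
    (realQuantile μ p : EReal) = quantile μ p := by
  refine EReal.coe_toReal (fun h => ?_) (fun h => ?_)
  · obtain ⟨y, hy⟩ := ((tendsto_cdf_atTop μ).eventually (eventually_gt_nhds hp.2)).exists
    have := (quantile_le_coe_iff μ).2 hy.le
    simp [h] at this
  · obtain ⟨y, hy⟩ := ((tendsto_cdf_atBot μ).eventually (eventually_lt_nhds hp.1)).exists
    exact absurd ((quantile_le_coe_iff μ (p := p) (y := y)).1 (by simp [h])) (not_le.2 hy)

theorem realQuantile_le_iff (μ : Measure ℝ) [IsProbabilityMeasure μ] {p y : ℝ}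
    (hp : p ∈ Ioo (0 : ℝ) 1) : realQuantile μ p ≤ y ↔ p ≤ cdf μ y := by
  rw [← EReal.coe_le_coe_iff, coe_realQuantile μ hp, quantile_le_coe_iff]

theorem measurable_realQuantile (μ : Measure ℝ) : Measurable (realQuantile μ) :=
  (monotone_quantile μ).measurable.ereal_toReal

theorem ae_uniform01_mem_Ioo : ∀ᵐ p ∂uniform01, p ∈ Ioo (0 : ℝ) 1 := by
  rw [uniform01, ← restrict_Ioo_eq_restrict_Icc]
  exact ae_restrict_mem measurableSet_Ioo

/-- Inverse transform sampling. -/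
theorem map_realQuantile (μ : Measure ℝ) [IsProbabilityMeasure μ] :
    uniform01.map (realQuantile μ) = μ := by
  refine Measure.ext_of_Iic _ _ fun y => ?_
  rw [Measure.map_apply (measurable_realQuantile μ) measurableSet_Iic, ← ofReal_cdf μ y]
  have : realQuantile μ ⁻¹' Iic y =ᵐ[uniform01] Iic (cdf μ y) := by
    filter_upwards [ae_uniform01_mem_Ioo] with p hp
    exact propext (realQuantile_le_iff μ hp)
  rw [measure_congr this, uniform01, Measure.restrict_apply measurableSet_Iic,
    show Iic (cdf μ y) ∩ Icc 0 1 = Icc 0 (cdf μ y) by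
      ext p
      have := cdf_le_one μ y
      simp only [mem_inter_iff, mem_Iic, mem_Icc]
      constructor
      · tauto
      · intro h; exact ⟨h.2, h.1, h.2.trans this⟩]
  simp

/-- The distribution function of an atomless law is left-continuous. -/
theorem cdf_le_of_forall_lt (μ : Measure ℝ) [IsProbabilityMeasure μ] [NullSingletonClass μ]
    {x a : ℝ} (h : ∀ y < x, cdf μ y ≤ a) : cdf μ x ≤ a := by
  have h0 : (cdf μ).measure {x} = 0 := by rw [measure_cdf]; exact measure_singleton x
  rw [StieltjesFunction.measure_singleton, ENNReal.ofReal_eq_zero, sub_nonpos] at h0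
  refine h0.trans (le_of_tendsto ((monotone_cdf μ).tendsto_leftLim x) ?_)
  filter_upwards [self_mem_nhdsWithin] with y hy using h y hy

/-- The probability integral transform. -/
theorem map_cdf (μ : Measure ℝ) [IsProbabilityMeasure μ] [NullSingletonClass μ] :
    μ.map (cdf μ) = uniform01 := by
  conv_lhs => rw [← map_realQuantile μ]
  rw [Measure.map_map (by rw [map_realQuantile]; exact (monotone_cdf μ).measurable)
    (measurable_realQuantile μ)]
  conv_rhs => rw [← Measure.map_id (μ := uniform01)]
  refine Measure.map_congr ?_
  filter_upwards [ae_uniform01_mem_Ioo] with p hp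
  rw [map_realQuantile]
  refine le_antisymm (cdf_le_of_forall_lt μ fun y hy => ?_)
    ((realQuantile_le_iff μ hp).1 le_rfl)
  by_contra hc
  exact absurd ((realQuantile_le_iff μ hp).2 (not_le.1 hc).le) (not_le.2 hy)

/-- A sublevel set of the distribution function of an atomless law is a closed half-line. -/
theorem exists_cdf_le_iff (μ : Measure ℝ) [IsProbabilityMeasure μ] [NullSingletonClass μ]
    {a : ℝ} (ha : a ∈ Ioo (0 : ℝ) 1) : ∃ c, ∀ x, cdf μ x ≤ a ↔ x ≤ c := by
  obtain ⟨y₀, hy₀⟩ := ((tendsto_cdf_atBot μ).eventually (eventually_lt_nhds ha.1)).exists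
  obtain ⟨y₁, hy₁⟩ := ((tendsto_cdf_atTop μ).eventually (eventually_gt_nhds ha.2)).exists
  have hb : BddAbove {x | cdf μ x ≤ a} := ⟨y₁, fun x hx => by
    by_contra hc
    exact absurd (hy₁.trans_le (monotone_cdf μ (not_le.1 hc).le)) (not_lt.2 hx)⟩
  refine ⟨sSup {x | cdf μ x ≤ a}, fun x => ⟨fun h => le_csSup hb h, fun h => ?_⟩⟩
  refine cdf_le_of_forall_lt μ fun y hy => ?_
  obtain ⟨z, hz, hyz⟩ := exists_lt_of_lt_csSup ⟨y₀, hy₀.le⟩ (hy.trans_le h)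
  exact (monotone_cdf μ hyz.le).trans hz

/-! ### The ensemble p-value as a function of the p-values -/

theorem ae_pi_uniform01_mem_Ioo (K : ℕ) :
    ∀ᵐ p ∂(Measure.pi fun _ : Fin K => uniform01), ∀ k, p k ∈ Ioo (0 : ℝ) 1 :=
  ae_all_iff.2 fun k =>
    (measurePreserving_eval (fun _ : Fin K => uniform01) k).quasiMeasurePreserving.ae
      ae_uniform01_mem_Ioo

theorem measurable_pi_realQuantile (μ : Measure ℝ) (K : ℕ) :
    Measurable fun (p : Fin K → ℝ) k => realQuantile μ (p k) :=
  measurable_pi_lambda _ fun k => (measurable_realQuantile μ).comp (measurable_pi_apply k)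

theorem map_pi_realQuantile (μ : Measure ℝ) [IsProbabilityMeasure μ] (K : ℕ) :
    (Measure.pi fun _ : Fin K => uniform01).map (fun p k => realQuantile μ (p k))
      = Measure.pi fun _ : Fin K => μ := by
  have : ∀ _ : Fin K, SigmaFinite (uniform01.map (realQuantile μ)) := fun _ => by
    rw [map_realQuantile]; infer_instance
  rw [Measure.pi_map_pi fun _ => (measurable_realQuantile μ).aemeasurable]
  simp_rw [map_realQuantile]

theorem ensemblePval_of_mem_Ioo (S S' : Measure ℝ) [IsProbabilityMeasure S]
    [IsProbabilityMeasure S'] {K : ℕ} {p : Fin K → ℝ} (hp : ∀ k, p k ∈ Ioo (0 : ℝ) 1) :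
    ensemblePval S S' p = cdf S' ((K : ℝ)⁻¹ * ∑ k, realQuantile S (p k)) := by
  have e : ∑ k, quantile S (p k) = ((∑ k, realQuantile S (p k) : ℝ) : EReal) := by
    rw [Finset.sum_congr rfl fun k _ => (coe_realQuantile S (hp k)).symm]
    exact (map_sum (⟨⟨Real.toEReal, EReal.coe_zero⟩, EReal.coe_add⟩ : ℝ →+ EReal) _ _).symm
  rw [ensemblePval, ensembleStat, e, ← EReal.coe_mul, ecdf_coe]

theorem measurable_ensemblePval (S S' : Measure ℝ) [IsFiniteMeasure S'] (K : ℕ) :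
    Measurable (ensemblePval S S' (K := K)) := by
  refine (monotone_ecdf S').measurable.comp (measurable_const.mul ?_)
  exact Finset.measurable_sum _ fun k _ =>
    (monotone_quantile S).measurable.comp (measurable_pi_apply k)

theorem monotone_ensemblePval (S S' : Measure ℝ) [IsFiniteMeasure S'] (K : ℕ) :
    Monotone (ensemblePval S S' (K := K)) := fun p q h => by
  refine monotone_ecdf S' (mul_le_mul_of_nonneg_left ?_ ?_)
  · exact Finset.sum_le_sum fun k _ => monotone_quantile S (h k)
  · exact EReal.coe_nonneg.2 (inv_nonneg.2 (Nat.cast_nonneg _))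

/-! ### Product laws with a density -/

theorem pi_withDensity {ι : Type*} [Fintype ι] {μ : Measure ℝ} [IsProbabilityMeasure μ]
    {f : ℝ → ℝ≥0∞} (hf : Measurable f) [IsProbabilityMeasure (μ.withDensity f)] :
    (Measure.pi fun _ : ι => μ.withDensity f)
      = (Measure.pi fun _ : ι => μ).withDensity fun p => ∏ i, f (p i) := by
  refine Measure.pi_eq fun s hs => ?_
  rw [withDensity_apply _ (MeasurableSet.univ_pi hs),
    ← lintegral_indicator (MeasurableSet.univ_pi hs)]
  have e : ∀ p : ι → ℝ, (univ.pi s).indicator (fun p => ∏ i, f (p i)) p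
      = ∏ i, (s i).indicator f (p i) := by
    intro p
    by_cases hp : p ∈ univ.pi s
    · rw [indicator_of_mem hp]
      exact Finset.prod_congr rfl fun i _ => (indicator_of_mem (hp i (mem_univ i)) f).symm
    · rw [indicator_of_notMem hp]
      obtain ⟨i, hi⟩ : ∃ i, p i ∉ s i := by simpa using hp
      exact (Finset.prod_eq_zero (Finset.mem_univ i) (indicator_of_notMem hi f)).symm
  simp_rw [e]
  have hm : ∀ i, Measurable ((s i).indicator f) := fun i => hf.indicator (hs i)
  have hind : iIndepFun (fun i (p : ι → ℝ) => (s i).indicator f (p i))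
      (Measure.pi fun _ : ι => μ) := iIndepFun_pi fun i => (hm i).aemeasurable
  rw [lintegral_prod_eq_prod_lintegral_of_indepFun Finset.univ _ hind
    fun i => (hm i).comp (measurable_pi_apply i)]
  refine Finset.prod_congr rfl fun i _ => ?_
  rw [withDensity_apply _ (hs i), ← lintegral_indicator (hs i),
    ← (measurePreserving_eval (fun _ : ι => μ) i).lintegral_comp (hm i)]

theorem pi_absolutelyContinuous {ι : Type*} [Fintype ι] {μ ν : Measure ℝ}
    [IsProbabilityMeasure μ] [IsProbabilityMeasure ν] (h : ν ≪ μ) :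
    (Measure.pi fun _ : ι => ν) ≪ Measure.pi fun _ : ι => μ := by
  have e := Measure.withDensity_rnDeriv_eq ν μ h
  have : IsProbabilityMeasure (μ.withDensity (ν.rnDeriv μ)) := by rw [e]; infer_instance
  rw [← e, pi_withDensity (Measure.measurable_rnDeriv ν μ)]
  exact withDensity_absolutelyContinuous _ _

/-! ### A Neyman–Pearson argument against an improper limit of alternatives -/

/-- If no power is lost against the likelihood ratios `exp (-Tn n)`, where `Tn n` tends to the
statistic `T` from above, and the mean of `φ` equals that of the test `{T ≤ t}`, then `φ` is that
test almost surely. The function `exp (-T)` need not be integrable: as `Tn n ≥ T`,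
the product `(φ - ψ) * (1 - exp (t - Tn n))` is negative only where `T ≤ t`, and there it is at
least `-1`, so Fatou's lemma applies. -/
theorem ae_eq_of_integral_mul_exp_nonneg {Ω : Type*} [MeasurableSpace Ω] {μ : Measure Ω}
    [IsProbabilityMeasure μ] {φ ψ T : Ω → ℝ} {Tn : ℕ → Ω → ℝ} {t : ℝ}
    (hφ : Measurable φ) (hψ : Measurable ψ) (hTn : ∀ n, Measurable (Tn n))
    (hφ01 : ∀ x, φ x ∈ Icc (0 : ℝ) 1) (hψ01 : ∀ x, ψ x ∈ Icc (0 : ℝ) 1)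
    (hψ1 : ∀ᵐ x ∂μ, T x ≤ t → ψ x = 1) (hψ0 : ∀ᵐ x ∂μ, t < T x → ψ x = 0)
    (hle : ∀ n x, T x ≤ Tn n x) (hlim : ∀ x, Tendsto (fun n => Tn n x) atTop (𝓝 (T x)))
    (hbdd : ∀ n, ∃ C, ∀ x, Real.exp (-Tn n x) ≤ C)
    (h0 : ∫ x, (φ x - ψ x) ∂μ = 0)
    (hpos : ∀ n, 0 ≤ ∫ x, (φ x - ψ x) * Real.exp (-Tn n x) ∂μ) :
    φ =ᵐ[μ] ψ := by
  set h : Ω → ℝ := fun x => φ x - ψ x with hh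
  have hhm : Measurable h := hφ.sub hψ
  have hh1 : ∀ x, |h x| ≤ 1 := fun x => by
    have a := hφ01 x; have b := hψ01 x
    rw [abs_le]; constructor <;> simp only [hh] <;> linarith [a.1, a.2, b.1, b.2]
  have hhi : Integrable h μ := Integrable.of_bound hhm.aestronglyMeasurable 1
    (.of_forall fun x => by simpa using hh1 x)
  have hei : ∀ n, Integrable (fun x => h x * Real.exp (-Tn n x)) μ := fun n => by
    obtain ⟨C, hC⟩ := hbdd n
    refine Integrable.of_bound (hhm.mul (hTn n).neg.exp).aestronglyMeasurable C
      (.of_forall fun x => ?_)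
    rw [norm_mul, Real.norm_eq_abs, Real.norm_eq_abs, Real.abs_exp]
    calc |h x| * Real.exp (-Tn n x) ≤ 1 * Real.exp (-Tn n x) :=
          mul_le_mul_of_nonneg_right (hh1 x) (Real.exp_pos _).le
      _ ≤ C := by rw [one_mul]; exact hC x
  -- the gain of `φ` over `ψ`, with the sign reversed, against the tilted likelihood ratio
  set g : ℕ → Ω → ℝ := fun n x => h x * (1 - Real.exp (t - Tn n x)) with hg
  have hg' : ∀ n x, g n x = h x - Real.exp t * (h x * Real.exp (-Tn n x)) := fun n x => by
    simp only [hg]; rw [sub_eq_add_neg t, Real.exp_add]; ring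
  have hgi : ∀ n, Integrable (g n) μ := fun n => by
    have : g n = fun x => h x - Real.exp t * (h x * Real.exp (-Tn n x)) := funext (hg' n)
    rw [this]
    exact hhi.sub ((hei n).const_mul _)
  have hgint : ∀ n, ∫ x, g n x ∂μ ≤ 0 := fun n => by
    simp_rw [hg']
    rw [integral_sub hhi ((hei n).const_mul _), integral_const_mul, h0, zero_sub]
    exact neg_nonpos.2 (mul_nonneg (Real.exp_pos t).le (hpos n))
  have hgm : ∀ n, Measurable (g n) := fun n =>
    hhm.mul (measurable_const.sub (measurable_const.sub (hTn n)).exp)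
  have hglow : ∀ n, ∀ᵐ x ∂μ, 0 ≤ g n x + 1 := fun n => by
    filter_upwards [hψ1, hψ0] with x h1 h2
    simp only [hg]
    rcases le_or_gt (T x) t with hx | hx
    · have hn : h x ≤ 0 := by simp only [hh]; rw [h1 hx]; linarith [(hφ01 x).2]
      have := (abs_le.1 (hh1 x)).1
      nlinarith [Real.exp_pos (t - Tn n x)]
    · have hn : 0 ≤ h x := by simp only [hh]; rw [h2 hx]; linarith [(hφ01 x).1]
      have : Real.exp (t - Tn n x) ≤ 1 := Real.exp_le_one_iff.2 (by linarith [hle n x])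
      nlinarith
  have hlint : ∀ n, ∫⁻ x, ENNReal.ofReal (g n x + 1) ∂μ ≤ 1 := fun n => by
    rw [← ofReal_integral_eq_lintegral_ofReal (f := fun x => g n x + 1)
      ((hgi n).add (integrable_const 1)) (hglow n), integral_add (hgi n) (integrable_const 1)]
    simpa using hgint n
  set G : Ω → ℝ := fun x => h x * (1 - Real.exp (t - T x)) with hG
  have hGlim : ∀ x, Tendsto (fun n => g n x) atTop (𝓝 (G x)) := fun x =>
    ((tendsto_const_nhds.sub
      ((Real.continuous_exp.tendsto _).comp (tendsto_const_nhds.sub (hlim x)))).const_mul _)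
  have hGm : Measurable G := measurable_of_tendsto_metrizable hgm (tendsto_pi_nhds.2 hGlim)
  have hGpos : ∀ᵐ x ∂μ, 0 ≤ G x := by
    filter_upwards [hψ1, hψ0] with x h1 h2
    simp only [hG]
    rcases le_or_gt (T x) t with hx | hx
    · have hn : h x ≤ 0 := by simp only [hh]; rw [h1 hx]; linarith [(hφ01 x).2]
      have : 1 ≤ Real.exp (t - T x) := Real.one_le_exp (by linarith)
      nlinarith
    · have hn : 0 ≤ h x := by simp only [hh]; rw [h2 hx]; linarith [(hφ01 x).1]
      have : Real.exp (t - T x) ≤ 1 := Real.exp_le_one_iff.2 (by linarith)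
      nlinarith
  have hFatou : ∫⁻ x, ENNReal.ofReal (G x + 1) ∂μ ≤ 1 := by
    have e : ∀ x, ENNReal.ofReal (G x + 1)
        = liminf (fun n => ENNReal.ofReal (g n x + 1)) atTop := fun x =>
      ((ENNReal.tendsto_ofReal ((hGlim x).add_const 1)).liminf_eq).symm
    simp_rw [e]
    refine (lintegral_liminf_le fun n => ((hgm n).add_const 1).ennreal_ofReal).trans ?_
    exact (liminf_le_liminf (.of_forall hlint)).trans (by simp)
  have hG0 : ∀ᵐ x ∂μ, G x = 0 := by
    have e : ∫⁻ x, ENNReal.ofReal (G x + 1) ∂μ = (∫⁻ x, ENNReal.ofReal (G x) ∂μ) + 1 := by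
      rw [lintegral_congr_ae (g := fun x => ENNReal.ofReal (G x) + 1)]
      · rw [lintegral_add_right _ measurable_const]; simp
      · filter_upwards [hGpos] with x hx
        rw [ENNReal.ofReal_add hx zero_le_one, ENNReal.ofReal_one]
    have z : ∫⁻ x, ENNReal.ofReal (G x) ∂μ = 0 := by
      rw [e] at hFatou
      by_contra hc
      exact absurd hFatou (not_le.2 (by
        conv_lhs => rw [← zero_add (1 : ℝ≥0∞)]
        exact ENNReal.add_lt_add_right ENNReal.one_ne_top (pos_iff_ne_zero.2 hc)))
    rw [lintegral_eq_zero_iff hGm.ennreal_ofReal] at z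
    filter_upwards [z, hGpos] with x hx hx'
    exact le_antisymm (ENNReal.ofReal_eq_zero.1 hx) hx'
  -- on the boundary `T = t` the test `ψ` rejects, so that `φ ≤ ψ` almost surely
  have hneg : ∀ᵐ x ∂μ, 0 ≤ -h x := by
    filter_upwards [hG0, hψ1] with x hx h1
    by_cases hT : T x = t
    · simp only [hh]; rw [h1 hT.le]; linarith [(hφ01 x).2]
    · have : 1 - Real.exp (t - T x) ≠ 0 := by
        rw [sub_ne_zero, ne_comm, Ne, Real.exp_eq_one_iff, sub_eq_zero]
        exact fun e => hT e.symm
      have : h x = 0 := (mul_eq_zero.1 hx).resolve_right this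
      simp [this]
  have := (integral_eq_zero_iff_of_nonneg_ae hneg hhi.neg).1 (by
    rw [integral_neg, h0, neg_zero])
  filter_upwards [this] with x hx
  have : -h x = 0 := hx
  simp only [hh] at this
  linarith

/-! ### Tests that do at least as well against all nonincreasing densities -/

theorem withDensity_exp_ne_uniform01 (c : ℝ≥0∞) {r : ℝ} (hr : r ≠ 0) (hc0 : c ≠ 0) (hc : c ≠ ∞) :
    uniform01.withDensity (fun p => c * ENNReal.ofReal (Real.exp (r * p))) ≠ uniform01 := by
  intro h
  have hm : Measurable fun p : ℝ => c * ENNReal.ofReal (Real.exp (r * p)) := by fun_prop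
  conv_rhs at h => rw [← withDensity_one (μ := uniform01)]
  have hae := (withDensity_eq_iff (μ := uniform01) measurable_one.aemeasurable hm.aemeasurable
    (by simp)).1 h.symm
  have hnull : uniform01 {p | (1 : ℝ≥0∞) = c * ENNReal.ofReal (Real.exp (r * p))} = 0 := by
    refine Measure.absolutelyContinuous_of_le Measure.restrict_le_self
      (Set.Subsingleton.measure_zero (fun p hp q hq => ?_) volume)
    have e : c * ENNReal.ofReal (Real.exp (r * p)) = c * ENNReal.ofReal (Real.exp (r * q)) :=
      Eq.trans (Eq.symm hp) hq
    rw [ENNReal.mul_right_inj hc0 hc,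
      ENNReal.ofReal_eq_ofReal_iff (Real.exp_pos _).le (Real.exp_pos _).le,
      Real.exp_eq_exp] at e
    exact mul_left_cancel₀ hr e
  have hone : ∀ᵐ p ∂uniform01, False := by
    filter_upwards [hae, measure_eq_zero_iff_ae_notMem.1 hnull] with p h1 h2
    exact h2 h1
  exact IsProbabilityMeasure.ne_zero uniform01 (by simpa using hone)

theorem lintegral_uniform01_ne_zero {f : ℝ → ℝ≥0∞} (hf : Measurable f)
    (h : ∀ p ∈ Ioo (0 : ℝ) 1, 0 < f p) : ∫⁻ p, f p ∂uniform01 ≠ 0 := by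
  rw [Ne, lintegral_eq_zero_iff hf]
  intro h0
  have : ∀ᵐ p ∂uniform01, False := by
    filter_upwards [h0, ae_uniform01_mem_Ioo] with p hp hp'
    exact (h p hp').ne' hp
  exact IsProbabilityMeasure.ne_zero uniform01 (by simpa using this)

/-- Nonnegativity of the integral of `h` under all nonuniform nonincreasing densities, in a form
free of normalizations. -/
theorem integral_mul_prod_nonneg {K : ℕ} {h : (Fin K → ℝ) → ℝ}
    (hpos : ∀ Q : Measure ℝ, HasNonincreasingDensity Q → Q ≠ uniform01 →
      0 ≤ ∫ p, h p ∂(Measure.pi fun _ : Fin K => Q))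
    {f : ℝ → ℝ≥0∞} (hanti : Antitone f) {C : ℝ≥0∞} (hC : C ≠ ∞)
    (hfC : ∀ p, f p ≤ C) (hf0 : ∫⁻ p, f p ∂uniform01 ≠ 0)
    (hunif : uniform01.withDensity (fun p => (∫⁻ p, f p ∂uniform01)⁻¹ * f p) = uniform01 →
      0 ≤ ∫ p, h p ∂(Measure.pi fun _ : Fin K => uniform01)) :
    0 ≤ ∫ p, h p * ∏ k, (f (p k)).toReal ∂(Measure.pi fun _ : Fin K => uniform01) := by
  have hf : Measurable f := hanti.measurable
  set c : ℝ≥0∞ := ∫⁻ p, f p ∂uniform01 with hc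
  have hct : c ≠ ∞ := ((lintegral_mono hfC).trans_lt (by simpa using hC.lt_top)).ne
  set Q := uniform01.withDensity fun p => c⁻¹ * f p with hQ
  have hm : Measurable fun p => c⁻¹ * f p := measurable_const.mul hf
  have hQp : IsProbabilityMeasure Q := ⟨by
    rw [hQ, withDensity_apply _ MeasurableSet.univ, Measure.restrict_univ,
      lintegral_const_mul _ hf, ← hc, ENNReal.inv_mul_cancel hf0 hct]⟩
  have hQd : HasNonincreasingDensity Q :=
    ⟨hQp, _, fun p _ q _ hpq => mul_le_mul_right (hanti hpq) _, rfl⟩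
  have key : 0 ≤ ∫ p, h p ∂(Measure.pi fun _ : Fin K => Q) := by
    by_cases hQu : Q = uniform01
    · rw [hQu]; exact hunif hQu
    · exact hpos Q hQd hQu
  have hpi : (Measure.pi fun _ : Fin K => Q) = _ := pi_withDensity (ι := Fin K) hm
  rw [hpi, integral_withDensity_eq_integral_toReal_smul
    (Finset.measurable_prod Finset.univ fun k _ => by fun_prop)
    (.of_forall fun p => ENNReal.prod_lt_top fun k _ =>
      ENNReal.mul_lt_top (ENNReal.inv_lt_top.2 (pos_iff_ne_zero.2 hf0))
        ((hfC _).trans_lt hC.lt_top))] at key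
  have e : ∀ p : Fin K → ℝ, (∏ k, c⁻¹ * f (p k)).toReal • h p
      = (c⁻¹.toReal ^ K) * (h p * ∏ k, (f (p k)).toReal) := fun p => by
    rw [ENNReal.toReal_prod]
    simp_rw [ENNReal.toReal_mul]
    rw [Finset.prod_mul_distrib, Finset.prod_const, Finset.card_fin, smul_eq_mul]
    ring
  simp_rw [e] at key
  rw [integral_const_mul] at key
  exact nonneg_of_mul_nonneg_right key
    (pow_pos (ENNReal.toReal_pos (ENNReal.inv_ne_zero.2 hct) (ENNReal.inv_ne_top.2 hf0)) K)

/-- The uniform law is a limit of nonuniform laws with nonincreasing densities. -/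
theorem integral_uniform_nonneg {K : ℕ} {h : (Fin K → ℝ) → ℝ} (hm : Measurable h)
    (hb : ∀ p, |h p| ≤ 1)
    (hpos : ∀ Q : Measure ℝ, HasNonincreasingDensity Q → Q ≠ uniform01 →
      0 ≤ ∫ p, h p ∂(Measure.pi fun _ : Fin K => Q)) :
    0 ≤ ∫ p, h p ∂(Measure.pi fun _ : Fin K => uniform01) := by
  -- the clipping `max p 0` only serves to keep the density bounded off `[0, 1]`
  set r : ℕ → ℝ := fun n => -(1 / ((n : ℝ) + 1)) with hr
  have hrneg : ∀ n, r n < 0 := fun n => neg_neg_of_pos (by positivity)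
  set f : ℕ → ℝ → ℝ := fun n p => Real.exp (r n * max p 0) with hf
  have hfm : ∀ n, Measurable (f n) := fun n => by simp only [hf]; fun_prop
  have hf1 : ∀ n p, f n p ≤ 1 := fun n p =>
    Real.exp_le_one_iff.2 (mul_nonpos_of_nonpos_of_nonneg (hrneg n).le (le_max_right _ _))
  have hn : ∀ n, 0 ≤ ∫ p, h p * ∏ k, f n (p k) ∂(Measure.pi fun _ : Fin K => uniform01) := by
    intro n
    have hfm' : Measurable fun p => ENNReal.ofReal (f n p) := (hfm n).ennreal_ofReal
    have h0 : ∫⁻ p, ENNReal.ofReal (f n p) ∂uniform01 ≠ 0 :=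
      lintegral_uniform01_ne_zero hfm' fun p _ => by simpa [hf] using Real.exp_pos _
    have ht : ∫⁻ p, ENNReal.ofReal (f n p) ∂uniform01 ≠ ∞ :=
      ((lintegral_mono fun p => ENNReal.ofReal_le_one.2 (hf1 n p)).trans_lt (by simp)).ne
    have := integral_mul_prod_nonneg hpos (fun p q hpq => ENNReal.ofReal_le_ofReal
      (Real.exp_le_exp.2 (mul_le_mul_of_nonpos_left (max_le_max hpq le_rfl) (hrneg n).le)))
      ENNReal.one_ne_top (fun p => ENNReal.ofReal_le_one.2 (hf1 n p)) h0 (fun hu => by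
        refine absurd hu ?_
        rw [withDensity_congr_ae (g := fun p => (∫⁻ p, ENNReal.ofReal (f n p) ∂uniform01)⁻¹
          * ENNReal.ofReal (Real.exp (r n * p)))]
        · exact withDensity_exp_ne_uniform01 _ (hrneg n).ne (ENNReal.inv_ne_zero.2 ht)
            (ENNReal.inv_ne_top.2 h0)
        · filter_upwards [ae_uniform01_mem_Ioo] with p hp
          simp only [hf]
          rw [max_eq_left hp.1.le])
    simpa only [ENNReal.toReal_ofReal (Real.exp_pos _).le, hf] using this
  have hlim : Tendsto (fun n => ∫ p, h p * ∏ k, f n (p k) ∂(Measure.pi fun _ : Fin K => uniform01))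
      atTop (𝓝 (∫ p, h p * ∏ _k : Fin K, (1 : ℝ) ∂(Measure.pi fun _ : Fin K => uniform01))) := by
    refine tendsto_integral_of_dominated_convergence (fun _ => 1) (fun n => ?_)
      (integrable_const _) (fun n => .of_forall fun p => ?_) (.of_forall fun p => ?_)
    · exact (hm.mul (Finset.measurable_prod _ fun k _ =>
        (hfm n).comp (measurable_pi_apply k))).aestronglyMeasurable
    · have h1 : ∏ k, f n (p k) ≤ 1 :=
        Finset.prod_le_one (fun k _ => (Real.exp_pos _).le) fun k _ => hf1 n _
      have h2 : 0 ≤ ∏ k, f n (p k) := Finset.prod_nonneg fun k _ => (Real.exp_pos _).le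
      rw [norm_mul, Real.norm_eq_abs, Real.norm_eq_abs, abs_of_nonneg h2]
      exact mul_le_one₀ (hb p) h2 h1
    · refine (tendsto_finsetProd _ fun k _ => ?_).const_mul _
      have : Tendsto r atTop (𝓝 (-0)) := (tendsto_one_div_add_atTop_nhds_zero_nat).neg
      have := ((this.mul_const (max (p k) 0)).rexp)
      simpa [hf] using this
  simpa using ge_of_tendsto hlim (.of_forall hn)

/-- Among all tests, a test rejecting for small values of `∑ₖ F⁻¹(pₖ)` is determined, up to a null
set, by having no larger size and no smaller power against nonincreasing densities. The decisive
alternatives are the normalizations of `exp (-F⁻¹(p))`, truncated where `F⁻¹` is very negative. -/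
theorem ae_eq_of_power_le {K : ℕ} {φ ψ : (Fin K → ℝ) → ℝ} (hφ : IsTest φ) (hψ : IsTest ψ)
    (S : Measure ℝ) [IsProbabilityMeasure S] (t : ℝ)
    (hψ1 : ∀ᵐ p ∂(Measure.pi fun _ : Fin K => uniform01),
      ∑ k, realQuantile S (p k) ≤ t → ψ p = 1)
    (hψ0 : ∀ᵐ p ∂(Measure.pi fun _ : Fin K => uniform01),
      t < ∑ k, realQuantile S (p k) → ψ p = 0)
    (hsize : ∫ p, φ p ∂(Measure.pi fun _ : Fin K => uniform01)
      ≤ ∫ p, ψ p ∂(Measure.pi fun _ : Fin K => uniform01))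
    (hpow : ∀ Q : Measure ℝ, HasNonincreasingDensity Q → Q ≠ uniform01 →
      ∫ p, ψ p ∂(Measure.pi fun _ : Fin K => Q) ≤ ∫ p, φ p ∂(Measure.pi fun _ : Fin K => Q)) :
    φ =ᵐ[Measure.pi fun _ : Fin K => uniform01] ψ := by
  have hint : ∀ {χ : (Fin K → ℝ) → ℝ}, IsTest χ → ∀ (Q : Measure ℝ) [IsProbabilityMeasure Q],
      Integrable χ (Measure.pi fun _ : Fin K => Q) := fun {χ} hχ Q _ =>
    Integrable.of_bound hχ.1.aestronglyMeasurable 1 (.of_forall fun p => by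
      rw [Real.norm_eq_abs, abs_of_nonneg (hχ.2 p).1]; exact (hχ.2 p).2)
  have hpos : ∀ Q : Measure ℝ, HasNonincreasingDensity Q → Q ≠ uniform01 →
      0 ≤ ∫ p, (φ p - ψ p) ∂(Measure.pi fun _ : Fin K => Q) := fun Q hQ hne => by
    have := hQ.1
    rw [integral_sub (hint hφ Q) (hint hψ Q)]
    exact sub_nonneg.2 (hpow Q hQ hne)
  have hhm : Measurable fun p => φ p - ψ p := hφ.1.sub hψ.1
  have h0 : ∫ p, (φ p - ψ p) ∂(Measure.pi fun _ : Fin K => uniform01) = 0 := by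
    refine le_antisymm ?_ (integral_uniform_nonneg hhm (fun p => ?_) hpos)
    · rw [integral_sub (hint hφ _) (hint hψ _)]
      exact sub_nonpos.2 hsize
    · have a := hφ.2 p; have b := hψ.2 p
      rw [abs_le]; constructor <;> linarith [a.1, a.2, b.1, b.2]
  have hwm : ∀ n : ℕ, Measurable fun p => max (realQuantile S p) (-(n : ℝ)) := fun n =>
    (measurable_realQuantile S).max measurable_const
  refine ae_eq_of_integral_mul_exp_nonneg (T := fun p => ∑ k, realQuantile S (p k))
    (Tn := fun n p => ∑ k, max (realQuantile S (p k)) (-(n : ℝ))) (t := t) hφ.1 hψ.1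
    (fun n => Finset.measurable_sum _ fun k _ => (hwm n).comp (measurable_pi_apply k))
    hφ.2 hψ.2 hψ1 hψ0 (fun n p => Finset.sum_le_sum fun k _ => le_max_left _ _)
    (fun p => tendsto_finsetSum _ fun k _ => ?_) (fun n => ⟨Real.exp (K * n), fun p => ?_⟩) h0
    fun n => ?_
  · refine tendsto_const_nhds.congr' ?_
    obtain ⟨N, hN⟩ := exists_nat_ge (-realQuantile S (p k))
    filter_upwards [eventually_ge_atTop N] with n hn
    have : (N : ℝ) ≤ n := by exact_mod_cast hn
    exact (max_eq_left (by linarith)).symm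
  · refine Real.exp_le_exp.2 ?_
    rw [← Finset.sum_neg_distrib]
    refine (Finset.sum_le_card_nsmul _ _ (n : ℝ) fun k _ => ?_).trans (by simp)
    linarith [le_max_right (realQuantile S (p k)) (-(n : ℝ))]
  · -- the density, antitone on all of `ℝ` because it uses the extended quantile function
    set f : ℝ → ℝ≥0∞ := fun p => EReal.exp (-(max (quantile S p) ((-(n : ℝ) : ℝ) : EReal))) with hf
    have hanti : Antitone f := fun p q hpq => EReal.exp_monotone
      (EReal.neg_le_neg_iff.2 (max_le_max (monotone_quantile S hpq) le_rfl))
    have hfm : Measurable f := hanti.measurable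
    have hfe : ∀ p ∈ Ioo (0 : ℝ) 1,
        f p = ENNReal.ofReal (Real.exp (-(max (realQuantile S p) (-(n : ℝ))))) := fun p hp => by
      simp only [hf]
      rw [← coe_realQuantile S hp, ← (EReal.coe_strictMono.monotone).map_max, ← EReal.coe_neg,
        EReal.exp_coe]
    have hfC : ∀ p, f p ≤ ENNReal.ofReal (Real.exp n) := fun p => by
      rw [← EReal.exp_coe]
      refine EReal.exp_monotone ?_
      rw [EReal.neg_le, ← EReal.coe_neg]
      exact le_max_right _ _
    have hfint : ∫⁻ p, f p ∂uniform01 ≠ 0 :=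
      lintegral_uniform01_ne_zero hfm fun p hp => by simpa [hfe p hp] using Real.exp_pos _
    have e : ∫ p, (φ p - ψ p) * Real.exp (-∑ k, max (realQuantile S (p k)) (-(n : ℝ)))
          ∂(Measure.pi fun _ : Fin K => uniform01)
        = ∫ p, (φ p - ψ p) * ∏ k, (f (p k)).toReal ∂(Measure.pi fun _ : Fin K => uniform01) := by
      refine integral_congr_ae ?_
      filter_upwards [ae_pi_uniform01_mem_Ioo K] with p hp
      rw [← Finset.sum_neg_distrib, Real.exp_sum]
      congr 1
      refine Finset.prod_congr rfl fun k _ => ?_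
      rw [hfe _ (hp k), ENNReal.toReal_ofReal (Real.exp_pos _).le]
    rw [e]
    exact integral_mul_prod_nonneg hpos hanti ENNReal.ofReal_ne_top hfC hfint fun _ => h0.ge

/-! ### Validity, unbiasedness and admissibility -/

theorem map_ensemblePval {α β γ δ : ℝ} {S S' : Measure ℝ} {K : ℕ} (hK : 1 ≤ K)
    (hS : IsStable S α β γ δ) (hS' : IsStable S' α β ((K : ℝ) ^ (1 / α - 1) * γ) δ)
    (h : α ≠ 1 ∨ β = 0 ∨ K = 1) :
    (Measure.pi fun _ : Fin K => uniform01).map (ensemblePval S S') = uniform01 := by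
  have := hS.isProb
  have := hS'.isProb
  have := hS'.nullSingletonClass
  have hcdf : Measurable (cdf S') := (monotone_cdf S').measurable
  have hmean : Measurable fun x : Fin K → ℝ => (K : ℝ)⁻¹ * ∑ k, x k := by fun_prop
  have hp := measurable_pi_realQuantile S K
  calc (Measure.pi fun _ : Fin K => uniform01).map (ensemblePval S S')
      = (Measure.pi fun _ : Fin K => uniform01).map
          (cdf S' ∘ (fun x => (K : ℝ)⁻¹ * ∑ k, x k) ∘ fun p k => realQuantile S (p k)) := by
        refine Measure.map_congr ?_
        filter_upwards [ae_pi_uniform01_mem_Ioo K] with p hp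
        exact ensemblePval_of_mem_Ioo S S' hp
    _ = uniform01 := by
        rw [← Measure.map_map hcdf (hmean.comp hp), ← Measure.map_map hmean hp, map_pi_realQuantile,
          hS.map_mean hK hS' h, map_cdf]

theorem uniform01_real_Iic {a : ℝ} (ha : a ∈ Icc (0 : ℝ) 1) : uniform01.real (Iic a) = a := by
  rw [uniform01, measureReal_restrict_apply measurableSet_Iic,
    show Iic a ∩ Icc 0 1 = Icc 0 a by
      ext p
      simp only [mem_inter_iff, mem_Iic, mem_Icc]
      exact ⟨by tauto, fun h => ⟨h.2, h.1, h.2.trans ha.2⟩⟩]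
  simp [ha.1]

theorem pi_real_ensemblePval_le {α β γ δ : ℝ} {S S' : Measure ℝ} {K : ℕ} (hK : 1 ≤ K)
    (hS : IsStable S α β γ δ) (hS' : IsStable S' α β ((K : ℝ) ^ (1 / α - 1) * γ) δ)
    (h : α ≠ 1 ∨ β = 0 ∨ K = 1) {a : ℝ} (ha : a ∈ Icc (0 : ℝ) 1) :
    (Measure.pi fun _ : Fin K => uniform01).real {p | ensemblePval S S' p ≤ a} = a := by
  have := hS'.isProb
  have := map_measureReal_apply (μ := Measure.pi fun _ : Fin K => uniform01)
    (measurable_ensemblePval S S' K) (measurableSet_Iic (a := a))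
  rw [map_ensemblePval hK hS hS' h, uniform01_real_Iic ha] at this
  exact this.symm

/-- If `ν` is stochastically smaller than the uniform law, then its quantile function couples it
with a uniform variable lying above it; applied to each p-value, this bounds the rejection
probability of a monotone combination. -/
theorem pi_real_ensemblePval_le_of_le {S S' ν : Measure ℝ} [IsFiniteMeasure S']
    [IsProbabilityMeasure ν] {K : ℕ} (hν : ∀ u ∈ Ioo (0 : ℝ) 1, u ≤ ν.real (Iic u)) (a : ℝ) :
    (Measure.pi fun _ : Fin K => uniform01).real {p | ensemblePval S S' p ≤ a}
      ≤ (Measure.pi fun _ : Fin K => ν).real {p | ensemblePval S S' p ≤ a} := by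
  have hp := measurable_pi_realQuantile ν K
  rw [← map_pi_realQuantile ν, map_measureReal_apply hp
    (measurableSet_le (measurable_ensemblePval S S' K) measurable_const)]
  refine ENNReal.toReal_mono (measure_ne_top _ _) (measure_mono_ae ?_)
  filter_upwards [ae_pi_uniform01_mem_Ioo K] with p hp hpa
  refine le_trans (monotone_ensemblePval S S' K fun k => ?_) hpa
  rw [realQuantile_le_iff ν (hp k), cdf_eq_real]
  exact hν _ (hp k)

variable {X : Type*} [MeasurableSpace X]

theorem Subtest.measurable_pvals (H : Subtest X) (K : ℕ) : Measurable (H.pvals (K := K)) :=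
  measurable_pi_lambda _ fun k => H.measurable_pval.comp (measurable_pi_apply k)

theorem Subtest.isProbabilityMeasure_pvalLaw (H : Subtest X) (P : ProbabilityMeasure X) :
    IsProbabilityMeasure (H.pvalLaw P) :=
  Measure.isProbabilityMeasure_map H.measurable_pval.aemeasurable

theorem Subtest.map_pvals (H : Subtest X) (K : ℕ) (P : ProbabilityMeasure X) :
    (dataLaw K P).map (H.pvals (K := K)) = Measure.pi fun _ : Fin K => H.pvalLaw P := by
  have : ∀ _ : Fin K, SigmaFinite ((P : Measure X).map H.pval) := fun _ => by
    have := H.isProbabilityMeasure_pvalLaw P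
    exact inferInstanceAs (SigmaFinite (H.pvalLaw P))
  exact Measure.pi_map_pi (μ := fun _ : Fin K => (P : Measure X))
    fun _ => H.measurable_pval.aemeasurable

theorem Subtest.rejProb_eq (H : Subtest X) {K : ℕ} {φ : (Fin K → ℝ) → ℝ} (hφ : Measurable φ)
    (P : ProbabilityMeasure X) :
    H.rejProb φ P = ∫ p, φ p ∂(Measure.pi fun _ : Fin K => H.pvalLaw P) := by
  rw [← H.map_pvals, integral_map (H.measurable_pvals K).aemeasurable hφ.aestronglyMeasurable]
  rfl

theorem Subtest.dataLaw_real_ensemblePval_le (H : Subtest X) (S S' : Measure ℝ)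
    [IsFiniteMeasure S'] (K : ℕ) (P : ProbabilityMeasure X) (a : ℝ) :
    (dataLaw K P).real {x | ensemblePval S S' (H.pvals x) ≤ a}
      = (Measure.pi fun _ : Fin K => H.pvalLaw P).real {p | ensemblePval S S' p ≤ a} := by
  rw [← H.map_pvals, map_measureReal_apply (H.measurable_pvals K)
    (measurableSet_le (measurable_ensemblePval S S' K) measurable_const)]
  rfl

theorem Subtest.pvalLaw_absolutelyContinuous_uniform01 (H : Subtest X) {P : ProbabilityMeasure X}
    (h : H.pvalLaw P ≪ volume) : H.pvalLaw P ≪ uniform01 := by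
  refine Measure.AbsolutelyContinuous.mk fun s hs h0 => ?_
  rw [uniform01, Measure.restrict_apply hs] at h0
  have h1 := h h0
  rw [Subtest.pvalLaw, Measure.map_apply H.measurable_pval (hs.inter measurableSet_Icc)] at h1
  rw [Subtest.pvalLaw, Measure.map_apply H.measurable_pval hs]
  refine measure_mono_null (fun x hx => ?_) h1
  exact ⟨hx, H.pval_mem x⟩

theorem isTest_ensembleTest (S S' : Measure ℝ) [IsFiniteMeasure S'] (K : ℕ) (a : ℝ) :
    IsTest (ensembleTest S S' K a) := by
  refine ⟨measurable_const.indicator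
    (measurableSet_le (measurable_ensemblePval S S' K) measurable_const), fun p => ?_⟩
  unfold ensembleTest
  by_cases h : p ∈ {p : Fin K → ℝ | ensemblePval S S' p ≤ a}
  · rw [indicator_of_mem h]; simp
  · rw [indicator_of_notMem h]; simp

/-- Admissibility needs no relation between `S` and `S'` beyond the absence of atoms of `S'`: the
ensemble test rejects for small values of `∑ₖ F_S⁻¹(pₖ)` whatever its size. -/
theorem isAdmissible_ensembleTest (H : Subtest X) (hH : H.IsExact) (hnull : H.null.Nonempty)
    (halt : H.IsNonparametric) (S S' : Measure ℝ) [IsProbabilityMeasure S]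
    [IsProbabilityMeasure S'] [NullSingletonClass S'] {K : ℕ} (hK : 1 ≤ K) {a : ℝ}
    (ha : a ∈ Ioo (0 : ℝ) 1) : H.IsAdmissible (ensembleTest S S' K a) := by
  have hψ := isTest_ensembleTest S S' K a
  refine ⟨hψ, fun φ hφ hdom => ?_⟩
  obtain ⟨hnull_le, halt_le, hstrict⟩ := hdom
  obtain ⟨c, hc⟩ := exists_cdf_le_iff S' ha
  have hK0 : (0 : ℝ) < K := by exact_mod_cast hK
  have hmem : ∀ p : Fin K → ℝ, (∀ k, p k ∈ Ioo (0 : ℝ) 1) →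
      (ensemblePval S S' p ≤ a ↔ ∑ k, realQuantile S (p k) ≤ K * c) := fun p hp => by
    rw [ensemblePval_of_mem_Ioo S S' hp, hc, inv_mul_le_iff₀ hK0]
  have hae : φ =ᵐ[Measure.pi fun _ : Fin K => uniform01] ensembleTest S S' K a := by
    refine ae_eq_of_power_le hφ hψ S (K * c) ?_ ?_ ?_ fun Q hQ hne => ?_
    · filter_upwards [ae_pi_uniform01_mem_Ioo K] with p hp h
      exact indicator_of_mem (s := {p : Fin K → ℝ | ensemblePval S S' p ≤ a})
        ((hmem p hp).2 h) _
    · filter_upwards [ae_pi_uniform01_mem_Ioo K] with p hp h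
      exact indicator_of_notMem (s := {p : Fin K → ℝ | ensemblePval S S' p ≤ a})
        (fun h' => absurd ((hmem p hp).1 h') (not_le.2 h)) _
    · obtain ⟨P, hP⟩ := hnull
      have := hnull_le P hP
      rwa [H.rejProb_eq hφ.1, H.rejProb_eq hψ.1, hH P hP] at this
    · obtain ⟨P, hP, rfl⟩ := halt.2 Q hQ hne
      have := halt_le P hP
      rwa [H.rejProb_eq hφ.1, H.rejProb_eq hψ.1] at this
  have heq : ∀ P : ProbabilityMeasure X, H.pvalLaw P ≪ uniform01 →
      H.rejProb φ P = H.rejProb (ensembleTest S S' K a) P := fun P hP => by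
    have := H.isProbabilityMeasure_pvalLaw P
    rw [H.rejProb_eq hφ.1, H.rejProb_eq hψ.1]
    exact integral_congr_ae ((pi_absolutelyContinuous hP).ae_eq hae)
  rcases hstrict with ⟨P, hP, hlt⟩ | ⟨P, hP, hlt⟩
  · rw [heq P (by rw [hH P hP])] at hlt
    exact lt_irrefl _ hlt
  · rw [heq P (H.pvalLaw_absolutelyContinuous_uniform01 (halt.1 P hP))] at hlt
    exact lt_irrefl _ hlt

end ECIT

theorem theorem1 {X : Type*} [MeasurableSpace X] (H : ECIT.Subtest X) (hH : H.IsExact)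
    (K : ℕ) (hK : 1 ≤ K) (α β γ δ : ℝ) (S S' : Measure ℝ)
    (hS : ECIT.IsStable S α β γ δ)
    (hS' : ECIT.IsStable S' α β ((K : ℝ) ^ (1 / α - 1) * γ) δ) :
    -- validity
    ((α ≠ 1 ∨ β = 0 ∨ K = 1) → ∀ P ∈ H.null,
      (ECIT.dataLaw K P).map (fun x => ECIT.ensemblePval S S' (H.pvals x)) = ECIT.uniform01 ∧
      ∀ a ∈ Icc (0 : ℝ) 1,
        (ECIT.dataLaw K P).real {x | ECIT.ensemblePval S S' (H.pvals x) ≤ a} = a) ∧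
    -- admissibility
    (H.null.Nonempty → H.IsNonparametric → ∀ a ∈ Ioo (0 : ℝ) 1,
      H.IsAdmissible (ECIT.ensembleTest S S' K a)) ∧
    -- unbiasedness
    ((α ≠ 1 ∨ β = 0 ∨ K = 1) → H.IsUnbiased → ∀ a ∈ Ioo (0 : ℝ) 1, ∀ P ∈ H.alt,
      a ≤ (ECIT.dataLaw K P).real {x | ECIT.ensemblePval S S' (H.pvals x) ≤ a}) := by
  have := hS.isProb
  have := hS'.isProb
  have := hS'.nullSingletonClass
  refine ⟨fun h P hP => ⟨?_, fun a ha => ?_⟩, fun hnull halt a ha => ?_,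
    fun h hunb a ha P hP => ?_⟩
  · have e := Measure.map_map (μ := ECIT.dataLaw K P) (ECIT.measurable_ensemblePval S S' K)
      (H.measurable_pvals K)
    rw [H.map_pvals, hH P hP, ECIT.map_ensemblePval hK hS hS' h] at e
    exact e.symm
  · rw [H.dataLaw_real_ensemblePval_le, hH P hP]
    exact ECIT.pi_real_ensemblePval_le hK hS hS' h ha
  · exact ECIT.isAdmissible_ensembleTest H hH hnull halt S S' hK ha
  · have := H.isProbabilityMeasure_pvalLaw P
    rw [H.dataLaw_real_ensemblePval_le]
    refine (ECIT.pi_real_ensemblePval_le hK hS hS' h (Ioo_subset_Icc_self ha)).ge.trans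
      (ECIT.pi_real_ensemblePval_le_of_le (fun u hu => ?_) a)
    rw [ECIT.Subtest.pvalLaw, map_measureReal_apply H.measurable_pval measurableSet_Iic]
    exact hunb u hu P hP
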